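/- Let $Q=(Q,\le,\odot)$ be a semicartesian quantale: $(Q,\le)$ is a complete lattice, $\odot$ is an associative binary operation on $Q$ that distributes over arbitrary joins in each variable, and $a\odot b\le a$ and $a\odot b\le b$ for all $a,b\in Q$ (neither commutativity nor a unit is assumed). View $Q$ as a small poset category and let $PSh(Q)$ be the category of functors $Q^{op}\to Set$. Let $Sh(Q)$ be the full subcategory of those presheaves $F$ that are sheaves: for every small (possibly empty) family $(u_i)_{i\in I}$ in $Q$ with $u=\bigvee_{i\in I}u_i$, and every family $(s_i\in F(u_i))_{i\in I}$ with $s_i|_{u_i\odot u_j}=s_j|_{u_i\odot u_j}$ for all $i,j\in I$, there is a unique $s\in F(u)$ with $s|_{u_i}=s_i$ for all $i\in I$. Put $\lambda=\max\{\mathrm{card}(Q)^+,\aleph_0\}$, which is a regular cardinal. Then: 1. $Sh(Q)$ is a $\lambda$-orthogonality class in $PSh(Q)$: there is a set $W$ of morphisms of $PSh(Q)$ with $\lambda$-presentable domains and codomains such that a presheaf $F$ is a sheaf if and only if, for every $f\colon X\to Y$ in $W$, every morphism $X\to F$ factors uniquely through $f$. 2. $Sh(Q)$ is a reflective subcategory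 of $PSh(Q)$: the inclusion $Sh(Q)\hookrightarrow PSh(Q)$ has a left adjoint (sheafification). 3. $Sh(Q)$ is closed in $PSh(Q)$ under small $\lambda$-filtered colimits, in particular under $\lambda$-directed colimits. 4. $Sh(Q)$ is locally $\lambda$-presentable. -/

import Mathlib

open CategoryTheory CategoryTheory.Limits Opposite

universe w v u

/-- A quantale is semicartesian if `a * b ≤ a` and `a * b ≤ b` for all `a`, `b`.
Neither commutativity nor a unit is required. -/
class IsSemicartesianQuantale (Q : Type u) [Semigroup Q] [CompleteLattice Q] [IsQuantale Q] :
    Prop where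
  mul_le_left (a b : Q) : a * b ≤ a
  mul_le_right (a b : Q) : a * b ≤ b

namespace QuantaleSheaf

/-- Presheaves of sets on `Q`, the quantale being viewed as a poset category. -/
abbrev PSh (Q : Type u) [CompleteLattice Q] : Type (u + 1) := Qᵒᵖ ⥤ Type u

/-- The restriction map `F u → F v` of a presheaf along `v ≤ u`. -/
def restr {Q : Type u} [CompleteLattice Q] (F : PSh Q) {v u : Q} (h : v ≤ u)
    (s : F.obj (op u)) : F.obj (op v) :=
  F.map (homOfLE h).op s

section

variable {Q : Type u} [Semigroup Q] [CompleteLattice Q] [IsQuantale Q]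
  [IsSemicartesianQuantale Q]

/-- A family `s i ∈ F (U i)` is compatible if `s i` and `s j` have the same restriction to
`U i * U j` for all indices `i`, `j`. -/
def Compatible (F : PSh Q) {I : Type u} (U : I → Q) (s : ∀ i, F.obj (op (U i))) : Prop :=
  ∀ i j : I,
    restr F (IsSemicartesianQuantale.mul_le_left (U i) (U j)) (s i) =
      restr F (IsSemicartesianQuantale.mul_le_right (U i) (U j)) (s j)

variable (Q) in
/-- A presheaf on `Q` is a sheaf if, for every (small, possibly empty) family `U` in `Q`, every
compatible family on `U` is the family of restrictions of exactly one section over `⨆ i, U i`. -/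
def IsSheaf : ObjectProperty (PSh Q) := fun F =>
  ∀ (I : Type u) (U : I → Q) (s : ∀ i, F.obj (op (U i))), Compatible F U s →
    ∃! t : F.obj (op (⨆ i, U i)), ∀ i, restr F (le_iSup U i) t = s i

variable (Q) in
/-- The category of sheaves on `Q`, a full subcategory of `PSh Q`. -/
abbrev Sh : Type (u + 1) := (IsSheaf Q).FullSubcategory

end

/-- The cardinal `max {card(Q)⁺, ℵ₀}`. -/
noncomputable def cardinalBound (Q : Type u) : Cardinal.{u} :=
  max (Order.succ (Cardinal.mk Q)) Cardinal.aleph0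

theorem cardinalBound_isRegular (Q : Type u) : (cardinalBound Q).IsRegular := by
  unfold cardinalBound
  rcases le_or_gt Cardinal.aleph0 (Cardinal.mk Q) with h | h
  · rw [max_eq_left (h.trans (Order.le_succ _))]
    exact Cardinal.isRegular_succ h
  · rw [max_eq_right (Order.succ_le_of_lt h)]
    exact Cardinal.isRegular_aleph0

instance fact_cardinalBound_isRegular (Q : Type u) : Fact (cardinalBound Q).IsRegular :=
  ⟨cardinalBound_isRegular Q⟩

end QuantaleSheaf

/-- A class `P` of objects of `C` is a `κ`-orthogonality class if it consists of exactly the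
objects `Z` orthogonal to some set `W` of morphisms between `κ`-presentable objects, i.e. such
that every morphism `X ⟶ Z` factors uniquely through `f`, for each `f : X ⟶ Y` in `W`. -/
def IsCardinalOrthogonalityClass {C : Type u} [Category.{v} C] (P : ObjectProperty C)
    (κ : Cardinal.{w}) [Fact κ.IsRegular] : Prop :=
  ∃ W : MorphismProperty C, MorphismProperty.IsSmall.{w} W ∧
    (∀ ⦃X Y : C⦄ (f : X ⟶ Y), W f → IsCardinalPresentable X κ ∧ IsCardinalPresentable Y κ) ∧
    P = W.isLocal

/-!
A cover `U : I → Q` has the same supremum as its set of members, so only covers by subsets of `Q`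
should matter. What an index adds is repetition: for `U i = U j = v` compatibility says that
`s i` and `s j` agree on `v * v`, which for `v * v ≠ v` is weaker than `s i = s j`. The sheaf
condition for the two-member cover `(v, v)` says exactly that `F v → F (v * v)` is injective, and
this removes the repetitions. So a presheaf is a sheaf as soon as it satisfies the sheaf condition
for the subsets of `Q` and for the covers `(v, v)`.

The presheaf of compatible families on `U` is corepresented by the multicoequalizer of the
`y (U i * U j)` over the `y (U i)`, so the sheaf condition for `U` is orthogonality to its
comparison map to `y (⨆ i, U i)`. This multicoequalizer is `κ`-presentable when `I` has fewer than
`κ` elements, and everything else holds for all orthogonality classes in locally presentable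
categories (Adámek–Rosický).
-/

lemma isCardinalPresentable_yoneda {C : Type u} [SmallCategory C] (κ : Cardinal.{u})
    [Fact κ.IsRegular] (X : C) : IsCardinalPresentable (yoneda.obj X) κ :=
  isCardinalPresentable_of_iso (uliftYonedaIsoYoneda.{u}.app X) κ

lemma hasCardinalLT_arrow_walkingMultispan {J : MultispanShape.{w, v}} {κ : Cardinal.{u}}
    (hκ : Cardinal.aleph0 ≤ κ) (hL : HasCardinalLT J.L κ) (hR : HasCardinalLT J.R κ) :
    HasCardinalLT (Arrow (WalkingMultispan J)) κ := by
  simp only [hasCardinalLT_iff_of_equiv (WalkingMultispan.arrowEquiv J),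
    hasCardinalLT_iff_of_equiv (WalkingMultispan.equiv J), hasCardinalLT_sum_iff _ _ _ hκ,
    hL, hR, and_self]

namespace IsCardinalOrthogonalityClass

variable {C : Type u} [Category.{v} C] {P : ObjectProperty C} {κ : Cardinal.{w}}
  [Fact κ.IsRegular]

lemma nonempty_reflective [LocallySmall.{w} C] [HasColimitsOfSize.{w, w} C]
    (hP : IsCardinalOrthogonalityClass P κ) : Nonempty (Reflective P.ι) := by
  obtain ⟨W, _, hW, rfl⟩ := hP
  have := W.isRightAdjoint_ι_isLocal κ hW
  exact ⟨{ L := _, adj := Adjunction.ofIsRightAdjoint _ }⟩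

lemma isClosedUnderColimitsOfShape (hP : IsCardinalOrthogonalityClass P κ)
    (J : Type*) [Category* J] [EssentiallySmall.{w} J] [IsCardinalFiltered J κ] :
    P.IsClosedUnderColimitsOfShape J := by
  obtain ⟨W, -, hW, rfl⟩ := hP
  exact W.isClosedUnderColimitsOfShape_isLocal J κ hW

lemma isCardinalLocallyPresentable_fullSubcategory [IsCardinalLocallyPresentable C κ]
    (hP : IsCardinalOrthogonalityClass P κ) :
    IsCardinalLocallyPresentable P.FullSubcategory κ := by
  obtain ⟨W, _, hW, rfl⟩ := hP
  exact W.isLocallyPresentable_isLocal κ hW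

end IsCardinalOrthogonalityClass

namespace QuantaleSheaf

lemma hasCardinalLT_cardinalBound (Q : Type u) : HasCardinalLT Q (cardinalBound Q) := by
  rw [hasCardinalLT_iff_cardinal_mk_lt]
  exact (Order.lt_succ _).trans_le (le_max_left _ _)

/-- The families that suffice to test the sheaf condition: the subsets of `Q`, each indexed by
itself, and the constant families `(v, v)`. -/
def testFamily {Q : Type u} : Set Q ⊕ Q → Σ I : Type u, I → Q
  | .inl S => ⟨S, (↑)⟩
  | .inr v => ⟨ULift.{u} Bool, fun _ => v⟩

lemma hasCardinalLT_testFamily {Q : Type u} {κ : Cardinal.{w}} (hκ : Cardinal.aleph0 ≤ κ)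
    (hQ : HasCardinalLT Q κ) : ∀ x : Set Q ⊕ Q, HasCardinalLT (testFamily x).1 κ
  | .inl _ => hQ.of_injective _ Subtype.val_injective
  | .inr _ => hasCardinalLT_of_finite (ULift Bool) _ hκ

section Restriction

variable {Q : Type u} [CompleteLattice Q] (F : PSh Q)

lemma restr_self {v : Q} (h : v ≤ v) (s : F.obj (op v)) : restr F h s = s :=
  ConcreteCategory.congr_hom (F.map_id (op v)) s

lemma restr_restr {w v u : Q} (h : w ≤ v) (h' : v ≤ u) (s : F.obj (op u)) :
    restr F h (restr F h' s) = restr F (h.trans h') s :=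
  (ConcreteCategory.congr_hom (F.map_comp (homOfLE h').op (homOfLE h).op) s).symm

lemma yonedaEquiv_map_comp {F : PSh Q} {v u : Q} (h : v ≤ u) (a : yoneda.obj u ⟶ F) :
    yonedaEquiv (yoneda.map (homOfLE h) ≫ a) = restr F h (yonedaEquiv a) :=
  (yonedaEquiv_naturality a (homOfLE h)).symm

end Restriction

variable {Q : Type u} [Semigroup Q] [CompleteLattice Q] [IsQuantale Q]
  [IsSemicartesianQuantale Q]

open IsSemicartesianQuantale

section SheafCondition

variable {F : PSh Q} {I J : Type u}

lemma Compatible.restr_eq {U : I → Q} {s : ∀ i, F.obj (op (U i))} (hs : Compatible F U s)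
    {i j : I} {w : Q} (h : w ≤ U i * U j) :
    restr F (h.trans (mul_le_left _ _)) (s i) = restr F (h.trans (mul_le_right _ _)) (s j) := by
  simpa only [restr_restr] using congrArg (restr F h) (hs i j)

variable (F) in
/-- The sheaf condition for a single family `U`, as a property of the presheaf `F`. -/
def IsSheafFor (U : I → Q) : Prop :=
  ∀ s : ∀ i, F.obj (op (U i)), Compatible F U s →
    ∃! t : F.obj (op (⨆ i, U i)), ∀ i, restr F (le_iSup U i) t = s i

lemma isSheafFor_iff_of_iSup_eq {U : I → Q} {u : Q} (hu : ⨆ i, U i = u) :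
    IsSheafFor F U ↔ ∀ s : ∀ i, F.obj (op (U i)), Compatible F U s →
      ∃! t : F.obj (op u), ∀ i, restr F ((le_iSup U i).trans_eq hu) t = s i := by
  subst hu
  rfl

lemma IsSheafFor.restr_mul_self_injective {v : Q}
    (hF : IsSheafFor F fun _ : ULift.{u} Bool => v) :
    Function.Injective (restr F (mul_le_left v v)) := by
  intro x y hxy
  rw [isSheafFor_iff_of_iSup_eq iSup_const] at hF
  obtain ⟨t, ht, -⟩ := hF (fun b => cond b.down x y) (by
    rintro ⟨a⟩ ⟨b⟩
    cases a <;> cases b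
    exacts [rfl, hxy.symm, hxy, rfl])
  exact (ht ⟨true⟩).symm.trans (ht ⟨false⟩)

lemma Compatible.exists_eq_comp {f : I → J} (hf : f.Surjective) {V : J → Q}
    (hinj : ∀ j, Function.Injective (restr F (mul_le_left (V j) (V j))))
    {s : ∀ i, F.obj (op (V (f i)))} (hs : Compatible F (fun i => V (f i)) s) :
    ∃ s' : ∀ j, F.obj (op (V j)), ∀ i, s' (f i) = s i := by
  have (j : J) : ∃ x : F.obj (op (V j)),
      ∀ i (hi : f i = j), restr F (congrArg V hi).le x = s i := by
    obtain ⟨k, rfl⟩ := hf j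
    refine ⟨s k, fun i hi => hinj (f i) ?_⟩
    rw [restr_restr]
    exact hs.restr_eq (mul_le_mul_left (congrArg V hi).le _)
  choose s' hs' using this
  exact ⟨s', fun i => by rw [← hs' (f i) i rfl, restr_self]⟩

lemma IsSheafFor.comp_surjective {f : I → J} (hf : f.Surjective) {V : J → Q}
    (hinj : ∀ j, Function.Injective (restr F (mul_le_left (V j) (V j))))
    (hV : IsSheafFor F V) : IsSheafFor F fun i => V (f i) := by
  rw [isSheafFor_iff_of_iSup_eq (hf.iSup_comp V)]
  intro s hs
  obtain ⟨s', hs'⟩ := hs.exists_eq_comp hf hinj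
  obtain rfl : (fun i => s' (f i)) = s := funext hs'
  have hcompat : Compatible F V s' := hf.forall₂.2 hs
  refine (existsUnique_congr fun t => ?_).1 (hV s' hcompat)
  exact hf.forall

lemma isSheaf_iff_forall_testFamily :
    IsSheaf Q F ↔ ∀ x : Set Q ⊕ Q, IsSheafFor F (testFamily x).2 := by
  refine ⟨fun hF x => hF _ _, fun hF I U => ?_⟩
  exact (hF (.inl (Set.range U))).comp_surjective Set.rangeFactorization_surjective
    fun v => (hF (.inr v)).restr_mul_self_injective

end SheafCondition

section CoverColimit

variable {I : Type u} (U : I → Q) {F : PSh Q}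

/-- The diagram of the representables on `U i * U j` and on `U i`, whose multicoequalizer
corepresents compatible families on `U`. -/
def overlapIndex : MultispanIndex (.prod I) (PSh Q) where
  left p := yoneda.obj (U p.1 * U p.2)
  right i := yoneda.obj (U i)
  fst p := yoneda.map (homOfLE (mul_le_left (U p.1) (U p.2)))
  snd p := yoneda.map (homOfLE (mul_le_right (U p.1) (U p.2)))

/-- The presheaf corepresenting compatible families on `U`. It need not be a subpresheaf of a
representable, since `v * v` may differ from `v`. -/
noncomputable abbrev coverColimit : PSh Q := multicoequalizer (overlapIndex U)

lemma compatible_yonedaEquiv_iff (a : ∀ i, yoneda.obj (U i) ⟶ F) :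
    Compatible F U (fun i => yonedaEquiv (a i)) ↔
      ∀ i j, yoneda.map (homOfLE (mul_le_left (U i) (U j))) ≫ a i =
        yoneda.map (homOfLE (mul_le_right (U i) (U j))) ≫ a j := by
  simp only [Compatible, ← yonedaEquiv_map_comp, EmbeddingLike.apply_eq_iff_eq]

/-- The tautological section of `coverColimit U` over `U i`, as a map from a representable. -/
noncomputable def coverι (i : I) : yoneda.obj (U i) ⟶ coverColimit U :=
  Multicoequalizer.π (overlapIndex U) i

lemma coverι_condition (i j : I) :
    yoneda.map (homOfLE (mul_le_left (U i) (U j))) ≫ coverι U i =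
      yoneda.map (homOfLE (mul_le_right (U i) (U j))) ≫ coverι U j :=
  Multicoequalizer.condition (overlapIndex U) (i, j)

/-- The universal property of `coverColimit U`. -/
noncomputable def coverColimitHomEquiv :
    (coverColimit U ⟶ F) ≃ {s : ∀ i, F.obj (op (U i)) // Compatible F U s} where
  toFun g := ⟨fun i => yonedaEquiv (coverι U i ≫ g), (compatible_yonedaEquiv_iff U _).2
    fun i j => by simp only [← Category.assoc, coverι_condition]⟩
  invFun s := Multicoequalizer.desc (overlapIndex U) F (fun i => yonedaEquiv.symm (s.1 i))
    fun p => (compatible_yonedaEquiv_iff U fun i => yonedaEquiv.symm (s.1 i)).1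
      (by simpa only [Equiv.apply_symm_apply] using s.2) p.1 p.2
  left_inv g := Multicoequalizer.hom_ext _ _ _ fun i =>
    (Multicoequalizer.π_desc ..).trans (yonedaEquiv.symm_apply_apply (coverι U i ≫ g))
  right_inv s := Subtype.ext <| funext fun i =>
    (congrArg yonedaEquiv (Multicoequalizer.π_desc ..)).trans (yonedaEquiv.apply_symm_apply (s.1 i))

/-- The comparison map from `coverColimit U` to the representable on the supremum of `U`:
orthogonality to it is the sheaf condition for `U`. -/
noncomputable def coverDesc : coverColimit U ⟶ yoneda.obj (⨆ i, U i) :=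
  Multicoequalizer.desc (overlapIndex U) _ (fun i => yoneda.map (homOfLE (le_iSup U i)))
    fun _ => (yoneda.map_comp _ _).symm.trans (yoneda.map_comp _ _)

lemma coverι_comp_coverDesc (i : I) :
    coverι U i ≫ coverDesc U = yoneda.map (homOfLE (le_iSup U i)) :=
  Multicoequalizer.π_desc (overlapIndex U) _ _ _ i

lemma coverColimitHomEquiv_coverDesc_comp (g : yoneda.obj (⨆ i, U i) ⟶ F) (i : I) :
    (coverColimitHomEquiv U (coverDesc U ≫ g)).1 i = restr F (le_iSup U i) (yonedaEquiv g) := by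
  rw [← yonedaEquiv_map_comp, ← coverι_comp_coverDesc, Category.assoc]
  rfl

lemma bijective_coverDesc_comp_iff :
    Function.Bijective (fun g : yoneda.obj (⨆ i, U i) ⟶ F => coverDesc U ≫ g) ↔
      IsSheafFor F U := by
  rw [← (coverColimitHomEquiv U).comp_bijective, Function.bijective_iff_existsUnique,
    Subtype.forall]
  refine forall₂_congr fun s hs => yonedaEquiv.existsUnique_congr fun {g} => ?_
  simp only [Function.comp_apply, Subtype.ext_iff, funext_iff, coverColimitHomEquiv_coverDesc_comp]

lemma isCardinalPresentable_coverColimit {κ : Cardinal.{u}} [Fact κ.IsRegular]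
    (hI : HasCardinalLT I κ) : IsCardinalPresentable (coverColimit U) κ := by
  have hκ : Cardinal.aleph0 ≤ κ := Cardinal.IsRegular.aleph0_le Fact.out
  have (k : WalkingMultispan (.prod I)) :
      IsCardinalPresentable ((overlapIndex U).multispan.obj k) κ := by
    cases k <;> exact isCardinalPresentable_yoneda κ _
  exact isCardinalPresentable_of_isColimit _ (colimit.isColimit (overlapIndex U).multispan) κ
    (hasCardinalLT_arrow_walkingMultispan hκ (hasCardinalLT_prod hκ hI hI) hI)

end CoverColimit

lemma isCardinalOrthogonalityClass_isSheaf {κ : Cardinal.{u}} [Fact κ.IsRegular]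
    (hQ : HasCardinalLT Q κ) : IsCardinalOrthogonalityClass (IsSheaf Q) κ := by
  refine ⟨.ofHoms fun x : Set Q ⊕ Q => coverDesc (testFamily x).2, inferInstance, ?_, ?_⟩
  · rintro _ _ _ ⟨x⟩
    have hx := hasCardinalLT_testFamily (Cardinal.IsRegular.aleph0_le Fact.out) hQ x
    exact ⟨isCardinalPresentable_coverColimit _ hx, isCardinalPresentable_yoneda κ _⟩
  · ext F
    simp only [isSheaf_iff_forall_testFamily, ← bijective_coverDesc_comp_iff]
    exact ⟨fun h _ _ _ ⟨x⟩ => h x, fun h x => h _ ⟨x⟩⟩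

end QuantaleSheaf

theorem mainTheorem7 (Q : Type u) [Semigroup Q] [CompleteLattice Q] [IsQuantale Q]
    [IsSemicartesianQuantale Q] :
    -- sheaves form an orthogonality class in presheaves
    IsCardinalOrthogonalityClass (QuantaleSheaf.IsSheaf Q) (QuantaleSheaf.cardinalBound Q) ∧
    -- the inclusion functor has a left adjoint
    Nonempty (Reflective (QuantaleSheaf.IsSheaf Q).ι) ∧
    -- closure under filtered (in particular, directed) colimits for this cardinal
    (∀ (J : Type u) [SmallCategory J] [IsCardinalFiltered J (QuantaleSheaf.cardinalBound Q)],
      (QuantaleSheaf.IsSheaf Q).IsClosedUnderColimitsOfShape J) ∧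
    -- local presentability
    IsCardinalLocallyPresentable (QuantaleSheaf.Sh Q) (QuantaleSheaf.cardinalBound Q) := by
  have hsheaf := QuantaleSheaf.isCardinalOrthogonalityClass_isSheaf
    (QuantaleSheaf.hasCardinalLT_cardinalBound Q)
  exact ⟨hsheaf, hsheaf.nonempty_reflective, fun J _ _ => hsheaf.isClosedUnderColimitsOfShape J,
    hsheaf.isCardinalLocallyPresentable_fullSubcategory⟩
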